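/- Let $S$ be a semigroup with set of idempotents $E(S)$. A (right) $S$-set is a set $X$ with a map $X\times S\to X$, $(x,s)\mapsto xs$, such that $x(st)=(xs)t$; morphisms of $S$-sets are $S$-equivariant maps. The tensor product $X\otimes_S Y$ of a right $S$-set $X$ and a left $S$-set $Y$ is the quotient of $X\times Y$ by the equivalence relation generated by $(xs,y)\sim(x,sy)$. The Cauchy completion $C(S)$ is the category whose objects are the idempotents of $S$ and whose morphisms $f\to e$ are the triples $(e,s,f)$ with $s\in S$ and $esf=s$, with composition $(e,s,f)(f,t,g)=(e,st,g)$. $\mathrm{PSh}(C(S))$ denotes the category of contravariant functors from $C(S)$ to sets. A Morita context for categories $A$ and $B$ is a category $U$ together with full, faithful and essentially surjective functors $A\to U$ and $B\to U$. (1) Say that $S$ has right local units if $S\,E(S)=S$, and call an $S$-set $X$ closed if the map $X\otimes_S S\to X$, $x\otimes s\mapsto xs$, is bijective. If $S$ and $T$ are semigroups with right local units, then $S$ and $T$ are Morita equivalent (that is, the category of closed $S$-sets is equivalent to the category of closed $T$-sets) if and only if there is a Morita context for $C(S)$ and $C(T)$. (2) Say that $S$ is a sandwich semigroup if $S\,E(S)\,S=S$.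 Let $\hom_S(S,X)$ be the set of $S$-equivariant maps $S\to X$, where $S$ acts on itself by right multiplication; it is an $S$-set by $(\alpha t)(s)=\alpha(ts)$, and $\hom_S(S,X)S$ is the $S$-subset of all $\alpha t$ with $\alpha\in\hom_S(S,X)$, $t\in S$. Call an $S$-set $X$ closed in the sense of Talwar if the map $\hom_S(S,X)S\otimes_S S\to X$, $\alpha t\otimes s\mapsto\alpha(ts)$, is bijective. If $S$ is a sandwich semigroup, then the category of $S$-sets closed in the sense of Talwar is equivalent to $\mathrm{PSh}(C(S))$. Consequently, if $S$ and $T$ are sandwich semigroups, then the categories of $S$-sets and of $T$-sets closed in the sense of Talwar are equivalent if and only if there is a Morita context for $C(S)$ and $C(T)$. -/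

import Mathlib

open CategoryTheory
open scoped RightActions

universe u

namespace SemigroupMorita

section Semigroups

variable (S : Type u) [Semigroup S]

/-- `S` has right local units: `S E(S) = S`, where `E(S)` is the set of idempotents of `S`. -/
def HasRightLocalUnits : Prop :=
  ∀ s : S, ∃ t e : S, IsIdempotentElem e ∧ t * e = s

/-- `S` is a sandwich semigroup: `S E(S) S = S`. -/
def IsSandwich : Prop :=
  ∀ s : S, ∃ t e r : S, IsIdempotentElem e ∧ t * e * r = s

end Semigroups

section CauchyCompletion

/-- The objects of the Cauchy completion `C(S)`: the idempotents of `S`. -/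
structure CauchyCompletion (S : Type u) [Semigroup S] : Type u where
  val : S
  idem : IsIdempotentElem val

variable {S : Type u} [Semigroup S]

/-- A morphism `f ⟶ e` of `C(S)` is a triple `(e, s, f)` with `e s f = s`. The composite of
`(f, t, g) : g ⟶ f` and `(e, s, f) : f ⟶ e` is `(e, s t, g) : g ⟶ e`; the identity of `e`
is `(e, e, e)`. -/
instance : SmallCategory (CauchyCompletion S) where
  Hom f e := {s : S // e.val * s * f.val = s}
  id e := ⟨e.val, by rw [e.idem.eq, e.idem.eq]⟩
  comp {g f e} t s := ⟨s.1 * t.1, by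
    have hs : e.val * s.1 = s.1 := by
      conv_lhs => rw [← s.2]
      rw [← mul_assoc, ← mul_assoc, e.idem.eq, s.2]
    have ht : t.1 * g.val = t.1 := by
      conv_lhs => rw [← t.2]
      rw [mul_assoc, g.idem.eq, t.2]
    rw [← mul_assoc, hs, mul_assoc, ht]⟩
  id_comp {f e} s := Subtype.ext (by
    change s.1 * f.val = s.1
    conv_lhs => rw [← s.2]
    rw [mul_assoc, f.idem.eq, s.2])
  comp_id {f e} s := Subtype.ext (by
    change e.val * s.1 = s.1
    conv_lhs => rw [← s.2]
    rw [← mul_assoc, ← mul_assoc, e.idem.eq, s.2])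
  assoc _ _ _ := Subtype.ext (mul_assoc _ _ _).symm

end CauchyCompletion

section RightSets

/-- A right `S`-set: a set with an action `x <• s` such that `x <• (s * t) = (x <• s) <• t`. -/
structure RightSet (S : Type u) [Semigroup S] : Type (u + 1) where
  carrier : Type u
  [action : SemigroupAction Sᵐᵒᵖ carrier]

attribute [instance] RightSet.action

/-- Morphisms of right `S`-sets are the `S`-equivariant maps. -/
instance (S : Type u) [Semigroup S] : LargeCategory (RightSet S) where
  Hom X Y := X.carrier →[Sᵐᵒᵖ] Y.carrier
  id X := MulActionHom.id Sᵐᵒᵖ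
  comp f g := g.comp f

/-- The tensor product `X ⊗_S Y` of a right `S`-set `X` and a left `S`-set `Y`: the quotient of
`X × Y` by the equivalence relation generated by `(x s, y) ∼ (x, s y)`. -/
def TensorProd (S X Y : Type u) [Semigroup S] [SemigroupAction Sᵐᵒᵖ X]
    [SemigroupAction S Y] : Type u :=
  Quot fun p q : X × Y => ∃ (x : X) (s : S) (y : Y), p = (x <• s, y) ∧ q = (x, s • y)

/-- `S` acts on itself on the left by multiplication. -/
instance (S : Type u) [Semigroup S] : SemigroupAction S S where
  mul_smul := mul_assoc

section Closed

variable (S X : Type u) [Semigroup S] [SemigroupAction Sᵐᵒᵖ X]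

/-- The map `X ⊗_S S → X`, `x ⊗ s ↦ x s`. -/
def tensorAct : TensorProd S X S → X :=
  Quot.lift (fun p => p.1 <• p.2) (by
    rintro _ _ ⟨x, s, t, rfl, rfl⟩
    change MulOpposite.op t • MulOpposite.op s • x = MulOpposite.op (s * t) • x
    rw [MulOpposite.op_mul, mul_smul])

/-- `X` is closed: `X ⊗_S S → X` is injective and surjective. -/
def IsClosedAct : Prop := Function.Bijective (tensorAct S X)

/-- `hom_S(S, X)`: the `S`-equivariant maps from `S`, acting on itself by right multiplication,
to `X`. -/
def RegularHom : Type u := S →[Sᵐᵒᵖ] X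

variable {S X}

/-- The map `α t : s ↦ α (t s)`, for `α ∈ hom_S(S, X)` and `t ∈ S`. -/
def RegularHom.translate (α : RegularHom S X) (t : S) : RegularHom S X where
  toFun s := MulActionHom.toFun α (t * s)
  map_smul' r s := by
    change MulActionHom.toFun α (t * (s * r.unop)) = r • MulActionHom.toFun α (t * s)
    rw [← mul_assoc]
    exact MulActionHom.map_smul' α r (t * s)

/-- `hom_S(S, X)` is a right `S`-set through `(α, t) ↦ α t`. -/
instance : SemigroupAction Sᵐᵒᵖ (RegularHom S X) where
  smul t α := α.translate t.unop
  mul_smul r t α := MulActionHom.ext fun s =>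
    congrArg (MulActionHom.toFun α) (mul_assoc t.unop r.unop s)

variable (S X)

/-- `hom_S(S, X) S`: the maps of the form `α t` with `α ∈ hom_S(S, X)` and `t ∈ S`. -/
def RegularHomMul : Type u := {β : RegularHom S X // ∃ (α : RegularHom S X) (t : S), β = α <• t}

/-- `hom_S(S, X) S` is a right `S`-subset of `hom_S(S, X)`. -/
instance : SemigroupAction Sᵐᵒᵖ (RegularHomMul S X) where
  smul t β := ⟨t • β.1, β.1, t.unop, rfl⟩
  mul_smul r t β := Subtype.ext (mul_smul r t β.1)

/-- The map `hom_S(S, X) S ⊗_S S → X`, `α t ⊗ s ↦ (α t)(s) = α (t s)`. -/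
def homTensorEval : TensorProd S (RegularHomMul S X) S → X :=
  Quot.lift (fun p => MulActionHom.toFun p.1.1 p.2) (by
    rintro _ _ ⟨β, s, t, rfl, rfl⟩
    rfl)

/-- `X` is closed in the sense of Talwar: `hom_S(S, X) S ⊗_S S → X` is an isomorphism. -/
def IsTalwarClosedAct : Prop := Function.Bijective (homTensorEval S X)

end Closed

variable (S : Type u) [Semigroup S]

/-- The category of closed right `S`-sets, a full subcategory of the right `S`-sets. -/
abbrev ClosedSet : Type (u + 1) :=
  ObjectProperty.FullSubcategory fun X : RightSet S => IsClosedAct S X.carrier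

/-- The category of right `S`-sets that are closed in the sense of Talwar. -/
abbrev TalwarClosedSet : Type (u + 1) :=
  ObjectProperty.FullSubcategory fun X : RightSet S => IsTalwarClosedAct S X.carrier

end RightSets

section MoritaContext

/-- A weak equivalence: a full and faithful functor that is essentially surjective on objects. -/
def IsWeakEquivalence {A B : Type u} [SmallCategory A] [SmallCategory B] (F : A ⥤ B) : Prop :=
  F.Full ∧ F.Faithful ∧ F.EssSurj

/-- There is a Morita context for `A` and `B`: a category `U` with weak equivalences
`A ⥤ U` and `B ⥤ U`. -/
def HasMoritaContext (A B : Type u) [SmallCategory A] [SmallCategory B] : Prop :=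
  ∃ (U : Type u) (_ : SmallCategory U) (F : A ⥤ U) (G : B ⥤ U),
    IsWeakEquivalence F ∧ IsWeakEquivalence G

end MoritaContext

end SemigroupMorita

/-! Send an `S`-set `X` to the presheaf `e ↦ X e` on `C(S)`, and a presheaf `P` to its tensor
product `P ⊗ S` with the functor `e ↦ e S`. The unit `P(f) → (P ⊗ S) f` is always bijective
(`PshTensor.unitPoint_bijective`), so the counit is bijective at every `P ⊗ S`, and presheaves are
equivalent to the `S`-sets with bijective counit `tensorCounit`. Both notions of closedness say
exactly that: `X ⊗ S` (right local units, with `X S = X`) and `hom_S(S, X) S ⊗ S` (sandwich) are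
each in bijection over `X` with the source of the counit. Hence closed sets are presheaves on
`C(S)`, and part (1) reduces to part (2). Idempotents split in `C(S)`, so `C(S)` is recovered from
its presheaves: up to isomorphism the representables are the objects for which every jointly
epimorphic family contains a split epimorphism. A Morita context amounts to an equivalence. -/

namespace SemigroupMorita

/-! ### Recovering an idempotent complete category from its presheaves -/

section Presheaves

universe v w v' w'

/-- The objects `P` such that every jointly epimorphic family of morphisms to `P` contains a
split epimorphism. -/
def splitsJointEpis (D : Type w) [Category.{v} D] : ObjectProperty D := fun P =>
  ∀ (I : Type u) (Q : I → D) (f : ∀ i, Q i ⟶ P),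
    (∀ (Z : D) (g h : P ⟶ Z), (∀ i, f i ≫ g = f i ≫ h) → g = h) → ∃ i, IsSplitEpi (f i)

lemma splitsJointEpis.map_equivalence {D : Type w} {D' : Type w'} [Category.{v} D]
    [Category.{v'} D'] (e : D ≌ D') {P : D} (hP : splitsJointEpis.{u} D P) :
    splitsJointEpis.{u} D' (e.functor.obj P) := by
  intro I Q f hf
  -- Transpose the family along the adjunction in which `e.inverse` is left adjoint to `e.functor`.
  let k i : e.inverse.obj (Q i) ⟶ P := (e.symm.toAdjunction.homEquiv (Q i) P).symm (f i)
  have hk i : f i = e.symm.unit.app (Q i) ≫ e.functor.map (k i) := by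
    have h := e.symm.toAdjunction.homEquiv_unit (f := k i)
    rw [Equiv.apply_symm_apply] at h
    exact h
  obtain ⟨i, ⟨⟨s, hs⟩⟩⟩ := hP I _ k (by
    intro Z g h hgh
    apply e.functor.map_injective
    apply hf
    intro i
    rw [hk i, Category.assoc, Category.assoc, ← Functor.map_comp, ← Functor.map_comp, hgh i])
  refine ⟨i, ⟨⟨e.functor.map s ≫ e.symm.unitInv.app (Q i), ?_⟩⟩⟩
  rw [hk i, Category.assoc, ← Category.assoc (e.symm.unitInv.app (Q i))]
  erw [e.symm.unitIso.inv_hom_id_app]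
  erw [Category.id_comp]
  rw [← Functor.map_comp, hs, CategoryTheory.Functor.map_id]

lemma splitsJointEpis.of_iso {D : Type w} [Category.{v} D] {P P' : D}
    (hP : splitsJointEpis.{u} D P) (φ : P ≅ P') : splitsJointEpis.{u} D P' := by
  intro I Q f hf
  obtain ⟨i, ⟨⟨s, hs⟩⟩⟩ := hP I Q (fun i => f i ≫ φ.inv) fun Z g h hgh => by
    rw [← cancel_epi φ.inv]
    exact hf Z _ _ fun i => by simpa using hgh i
  refine ⟨i, ⟨⟨φ.inv ≫ s, ?_⟩⟩⟩
  rw [← Category.assoc, Iso.comp_inv_eq, Category.id_comp] at hs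
  rw [Category.assoc, hs, φ.inv_hom_id]

variable {A : Type u} [SmallCategory A]

/-- The union of the images of a jointly epimorphic family is all of `yoneda.obj a`, so it contains
`𝟙 a`. By Yoneda, a preimage of `𝟙 a` under some `f i` is a section of `f i`. -/
lemma splitsJointEpis_yoneda (a : A) : splitsJointEpis.{u} (Aᵒᵖ ⥤ Type u) (yoneda.obj a) := by
  intro I Q f hf
  let R : Subfunctor (yoneda.obj a) := ⨆ i, Subfunctor.range (f i)
  have hR i : Subfunctor.range (f i) ≤ R := le_iSup (fun i => Subfunctor.range (f i)) i
  have : Epi R.ι := ⟨fun {Z} g h hgh => hf Z g h fun i => by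
    rw [← Subfunctor.lift_ι (f i) (hR i), Category.assoc, Category.assoc, hgh]⟩
  have hsurj : Function.Surjective (R.ι.app (Opposite.op a)) :=
    (epi_iff_surjective _).1 inferInstance
  obtain ⟨⟨x, hx⟩, hx1⟩ := hsurj (𝟙 a)
  obtain ⟨i, hi⟩ : ∃ i, x ∈ (Subfunctor.range (f i)).obj (Opposite.op a) := by
    simpa [R] using hx
  obtain ⟨q, hq⟩ := hi
  refine ⟨i, ⟨⟨yonedaEquiv.symm q, ?_⟩⟩⟩
  apply yonedaEquiv.injective
  rw [yonedaEquiv_comp, Equiv.apply_symm_apply, hq]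
  exact hx1

/-- The elements of `P` form a jointly epimorphic family from representables, so `P` is a retract of
one of them. The resulting idempotent comes from `A`, and splits there. -/
lemma essImage_yoneda_of_splitsJointEpis [IsIdempotentComplete A] {P : Aᵒᵖ ⥤ Type u}
    (hP : splitsJointEpis.{u} (Aᵒᵖ ⥤ Type u) P) : (yoneda (C := A)).essImage P := by
  obtain ⟨⟨c, x⟩, ⟨⟨s, hs⟩⟩⟩ := hP (Σ c : A, P.obj (Opposite.op c)) (fun i => yoneda.obj i.1)
    (fun i => yonedaEquiv.symm i.2) (by
      intro Z g h hgh
      ext ⟨c⟩ x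
      have h1 := congrArg yonedaEquiv (hgh ⟨c, x⟩)
      rwa [yonedaEquiv_comp, yonedaEquiv_comp, Equiv.apply_symm_apply] at h1)
  set r := yonedaEquiv.symm x
  have hp : yoneda.preimage (r ≫ s) ≫ yoneda.preimage (r ≫ s) = yoneda.preimage (r ≫ s) := by
    apply yoneda.map_injective
    rw [Functor.map_comp, Functor.map_preimage, Category.assoc, ← Category.assoc s r, hs,
      Category.id_comp]
  obtain ⟨b, i, e, hie, hei⟩ := IsIdempotentComplete.idempotents_split c _ hp
  have hei' : yoneda.map e ≫ yoneda.map i = r ≫ s := by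
    rw [← Functor.map_comp, hei, Functor.map_preimage]
  refine ⟨b, ⟨⟨yoneda.map i ≫ r, s ≫ yoneda.map e, ?_, ?_⟩⟩⟩
  · rw [Category.assoc, ← Category.assoc r, ← hei', Category.assoc, ← Functor.map_comp,
      ← Functor.map_comp, ← Functor.map_comp, hie, Category.comp_id, hie,
      CategoryTheory.Functor.map_id]
  · rw [Category.assoc, ← Category.assoc (yoneda.map e), hei', Category.assoc, hs,
      Category.comp_id, hs]

lemma splitsJointEpis_iff_essImage_yoneda [IsIdempotentComplete A] (P : Aᵒᵖ ⥤ Type u) :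
    splitsJointEpis.{u} (Aᵒᵖ ⥤ Type u) P ↔ (yoneda (C := A)).essImage P := by
  refine ⟨essImage_yoneda_of_splitsJointEpis, ?_⟩
  rintro ⟨a, ⟨φ⟩⟩
  exact (splitsJointEpis_yoneda a).of_iso φ

/-- Categories in which idempotents split are equivalent if their presheaf categories are. -/
lemma nonempty_equivalence_of_presheaf_equivalence {B : Type u} [SmallCategory B]
    [IsIdempotentComplete A] [IsIdempotentComplete B]
    (e : (Aᵒᵖ ⥤ Type u) ≌ (Bᵒᵖ ⥤ Type u)) : Nonempty (A ≌ B) := by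
  have h : (yoneda (C := B)).essImage.inverseImage e.functor = (yoneda (C := A)).essImage := by
    ext P
    change (yoneda (C := B)).essImage (e.functor.obj P) ↔ _
    rw [← splitsJointEpis_iff_essImage_yoneda, ← splitsJointEpis_iff_essImage_yoneda]
    exact ⟨fun hP => (hP.map_equivalence e.symm).of_iso (e.unitIso.app P).symm,
      fun hP => hP.map_equivalence e⟩
  exact ⟨(yoneda (C := A)).toEssImage.asEquivalence.trans
    ((e.congrFullSubcategory h).trans (yoneda (C := B)).toEssImage.asEquivalence.symm)⟩

lemma HasMoritaContext.nonempty_equivalence {B : Type u} [SmallCategory B]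
    (h : HasMoritaContext A B) : Nonempty (A ≌ B) := by
  obtain ⟨U, _, F, G, ⟨_, _, _⟩, ⟨_, _, _⟩⟩ := h
  have : F.IsEquivalence := {}
  have : G.IsEquivalence := {}
  exact ⟨F.asEquivalence.trans G.asEquivalence.symm⟩

lemma hasMoritaContext_of_equivalence {B : Type u} [SmallCategory B] (e : A ≌ B) :
    HasMoritaContext A B :=
  ⟨B, inferInstance, e.functor, 𝟭 B, ⟨inferInstance, inferInstance, inferInstance⟩,
    ⟨inferInstance, inferInstance, inferInstance⟩⟩

/-- Categories in which idempotents split have equivalent presheaf categories if and only if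
there is a Morita context for them. -/
lemma nonempty_presheaf_equivalence_iff {B : Type u} [SmallCategory B]
    [IsIdempotentComplete A] [IsIdempotentComplete B] :
    Nonempty ((Aᵒᵖ ⥤ Type u) ≌ (Bᵒᵖ ⥤ Type u)) ↔ HasMoritaContext A B := by
  constructor
  · rintro ⟨e⟩
    exact (nonempty_equivalence_of_presheaf_equivalence e).elim hasMoritaContext_of_equivalence
  · intro h
    obtain ⟨e⟩ := h.nonempty_equivalence
    exact ⟨e.op.congrLeft⟩

end Presheaves
-- Idempotents split in `C(S)`
section CauchyCompletion

variable {S : Type u} [Semigroup S]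

@[ext]
lemma CauchyCompletion.hom_ext {f e : CauchyCompletion S} {r t : f ⟶ e} (h : r.1 = t.1) : r = t :=
  Subtype.ext h

@[simp]
lemma CauchyCompletion.comp_val {g f e : CauchyCompletion S} (t : g ⟶ f) (s : f ⟶ e) :
    (t ≫ s).1 = s.1 * t.1 := rfl

lemma CauchyCompletion.val_mul_hom {f e : CauchyCompletion S} (r : f ⟶ e) :
    e.val * r.1 = r.1 := congrArg Subtype.val (Category.comp_id r)

lemma CauchyCompletion.hom_mul_val {f e : CauchyCompletion S} (r : f ⟶ e) :
    r.1 * f.val = r.1 := congrArg Subtype.val (Category.id_comp r)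

/-- The morphism `f ⟶ e` given by `s` with `e s = s` and `s f = s`. -/
def CauchyCompletion.homMk {f e : CauchyCompletion S} (s : S) (h : e.val * s = s)
    (h' : s * f.val = s) : f ⟶ e := ⟨s, by rw [h, h']⟩

@[simp]
lemma CauchyCompletion.homMk_val {f e : CauchyCompletion S} (s : S) (h : e.val * s = s)
    (h' : s * f.val = s) : (homMk s h h' : f ⟶ e).1 = s := rfl

/-- An idempotent endomorphism `(e, p, e)` has `p` idempotent in `S`, so `p` is itself an object,
and it splits the endomorphism. -/
instance : IsIdempotentComplete (CauchyCompletion S) where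
  idempotents_split e p hp := by
    have hpp : p.1 * p.1 = p.1 := congrArg Subtype.val hp
    refine ⟨⟨p.1, hpp⟩, CauchyCompletion.homMk p.1 (CauchyCompletion.val_mul_hom p) hpp,
      CauchyCompletion.homMk p.1 hpp (CauchyCompletion.hom_mul_val p), ?_, ?_⟩
    · ext; exact hpp
    · ext; exact hpp

end CauchyCompletion

/-! ### Fixed points of idempotents and the tensor product over `C(S)` -/

section FixedPoints

variable {S : Type u} [Semigroup S]

lemma act_act {X : Type u} [SemigroupAction Sᵐᵒᵖ X] (x : X) (s t : S) :
    (x <• s) <• t = x <• (s * t) := by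
  rw [MulOpposite.op_mul, mul_smul]

lemma map_act {X Y : Type u} [SemigroupAction Sᵐᵒᵖ X] [SemigroupAction Sᵐᵒᵖ Y]
    (φ : X →[Sᵐᵒᵖ] Y) (x : X) (s : S) : φ (x <• s) = φ x <• s := map_smul φ _ _

/-- The presheaf `e ↦ X e` on `C(S)`. -/
def fixedPoints (X : Type u) [SemigroupAction Sᵐᵒᵖ X] : (CauchyCompletion S)ᵒᵖ ⥤ Type u where
  obj e := {x : X // x <• e.unop.val = x}
  map {e f} r := TypeCat.ofHom fun x =>
    ⟨x.1 <• r.unop.1, by rw [act_act, CauchyCompletion.hom_mul_val]⟩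
  map_id e := by
    ext x
    exact x.2
  map_comp r t := by
    ext x
    exact (act_act x.1 _ _).symm

/-- The functor sending an `S`-set `X` to the presheaf `e ↦ X e`. -/
def fixedPointsFunctor (S : Type u) [Semigroup S] :
    RightSet S ⥤ ((CauchyCompletion S)ᵒᵖ ⥤ Type u) where
  obj X := fixedPoints X.carrier
  map {X Y} φ :=
    { app e := TypeCat.ofHom fun x => ⟨MulActionHom.toFun φ x.1, by
        conv_rhs => rw [← x.2]
        exact (map_act (show X.carrier →[Sᵐᵒᵖ] Y.carrier from φ) x.1 e.unop.val).symm⟩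
      naturality e f r := by
        ext x
        exact Subtype.ext
          (map_act (show X.carrier →[Sᵐᵒᵖ] Y.carrier from φ) x.1 r.unop.1) }

variable (P : (CauchyCompletion S)ᵒᵖ ⥤ Type u)

/-- The pairs `(p, s)` with `p ∈ P(e)` and `s ∈ e S`, for idempotents `e`. -/
structure PrePair : Type u where
  idem : CauchyCompletion S
  point : P.obj (Opposite.op idem)
  val : S
  val_eq : idem.val * val = val

/-- The relation `(p r, t) ∼ (p, r t)`. -/
inductive PrePair.Rel : PrePair P → PrePair P → Prop
  | mk {f e : CauchyCompletion S} (r : f ⟶ e) (p : P.obj (Opposite.op e)) (t : S)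
    (ht : f.val * t = t) :
    PrePair.Rel ⟨f, P.map r.op p, t, ht⟩
      ⟨e, p, r.1 * t, by rw [← mul_assoc, CauchyCompletion.val_mul_hom]⟩

/-- The tensor product of a presheaf `P` on `C(S)` with the functor `e ↦ e S`. -/
def PshTensor : Type u := Quot (PrePair.Rel P)

variable {P}

/-- The element `p ⊗ s`, for `p ∈ P(e)` and `s ∈ e S`. -/
def PshTensor.mk {e : CauchyCompletion S} (p : P.obj (Opposite.op e)) (s : S)
    (hs : e.val * s = s) : PshTensor P := Quot.mk _ ⟨e, p, s, hs⟩

lemma PshTensor.mk_congr {e : CauchyCompletion S} {p q : P.obj (Opposite.op e)} {s t : S}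
    (hs : e.val * s = s) (ht : e.val * t = t) (h : p = q) (h' : s = t) :
    mk p s hs = mk q t ht := by
  subst h h'; rfl

lemma PshTensor.mk_map {f e : CauchyCompletion S} (r : f ⟶ e) (p : P.obj (Opposite.op e)) (t : S)
    (ht : f.val * t = t) (ht' : e.val * (r.1 * t) = r.1 * t) :
    mk (P.map r.op p) t ht = mk p (r.1 * t) ht' :=
  Quot.sound (PrePair.Rel.mk r p t ht)

lemma PshTensor.ind {motive : PshTensor P → Prop}
    (h : ∀ (e : CauchyCompletion S) (p : P.obj (Opposite.op e)) (s : S) (hs : e.val * s = s),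
      motive (mk p s hs)) (z : PshTensor P) : motive z := by
  obtain ⟨e, p, s, hs⟩ := z
  exact h e p s hs

/-- Maps out of `PshTensor P`. -/
def PshTensor.lift {Z : Type u} (F : ∀ e : CauchyCompletion S, P.obj (Opposite.op e) → S → Z)
    (hF : ∀ (f e : CauchyCompletion S) (r : f ⟶ e) (p : P.obj (Opposite.op e)) (t : S),
      f.val * t = t → F f (P.map r.op p) t = F e p (r.1 * t)) : PshTensor P → Z :=
  Quot.lift (fun a => F a.idem a.point a.val) (by
    rintro _ _ ⟨r, p, t, ht⟩
    exact hF _ _ r p t ht)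

instance : SemigroupAction Sᵐᵒᵖ (PshTensor P) where
  smul r := Quot.map (fun a => ⟨a.idem, a.point, a.val * r.unop, by rw [← mul_assoc, a.val_eq]⟩)
    (by
      rintro _ _ ⟨t, p, s, hs⟩
      convert PrePair.Rel.mk t p (s * r.unop) (by rw [← mul_assoc, hs]) using 2
      exact mul_assoc _ _ _)
  mul_smul r t := by
    rintro ⟨e, p, s, hs⟩
    exact PshTensor.mk_congr _ _ rfl (mul_assoc _ _ _).symm

/-- The map `x ⊗ s ↦ x s` from the tensor product of `e ↦ X e` with `e ↦ e S` to `X`. -/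
def tensorCounit (X : Type u) [SemigroupAction Sᵐᵒᵖ X] : PshTensor (fixedPoints (S := S) X) → X :=
  PshTensor.lift (fun _ x s => x.1 <• s) (fun _ _ r p t _ => act_act p.1 r.1 t)

lemma tensorCounit_mk {X : Type u} [SemigroupAction Sᵐᵒᵖ X] {e : CauchyCompletion S}
    (x : (fixedPoints (S := S) X).obj (Opposite.op e)) (s : S) (hs : e.val * s = s) :
    tensorCounit X (PshTensor.mk x s hs) = x.1 <• s := rfl

/-- The element `p ⊗ f ∈ (P ⊗ S) f`, for `p ∈ P(f)`. -/
def PshTensor.unitPoint (f : CauchyCompletion S) (p : P.obj (Opposite.op f)) :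
    (fixedPoints (S := S) (PshTensor P)).obj (Opposite.op f) :=
  ⟨mk p f.val f.idem.eq, mk_congr _ _ rfl f.idem.eq⟩

lemma PshTensor.unitPoint_map {f e : CauchyCompletion S} (r : f ⟶ e) (p : P.obj (Opposite.op e)) :
    unitPoint f (P.map r.op p) =
      (fixedPoints (S := S) (PshTensor P)).map r.op (unitPoint e p) := by
  apply Subtype.ext
  refine (mk_map r p f.val f.idem.eq ?_).trans (mk_congr _ _ rfl ?_)
  · rw [← mul_assoc, CauchyCompletion.val_mul_hom]
  · exact (CauchyCompletion.hom_mul_val r).trans (CauchyCompletion.val_mul_hom r).symm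

/-- This is co-Yoneda: `(e S) f` is the set of morphisms `f ⟶ e`, so `(P ⊗ S) f` is `P` tensored
with the functor corepresented by `f`. -/
lemma PshTensor.unitPoint_bijective (f : CauchyCompletion S) :
    Function.Bijective (unitPoint (P := P) f) := by
  constructor
  -- The left inverse acts on `p` by `s f`, for `s ∈ e S`. It is written with `e s f` because
  -- `PshTensor.lift` takes functions defined on all of `S`.
  · let ψ : PshTensor P → P.obj (Opposite.op f) := PshTensor.lift
      (fun e p s => P.map (CauchyCompletion.homMk (e.val * s * f.val)
        (by rw [← mul_assoc, ← mul_assoc, e.idem.eq]) (by rw [mul_assoc, f.idem.eq]) :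
          f ⟶ e).op p) (by
        intro g e r p t ht
        rw [← Functor.map_comp_apply, ← op_comp]
        refine congrArg (fun m : f ⟶ e => P.map m.op p) ?_
        ext
        simp only [CauchyCompletion.comp_val, CauchyCompletion.homMk_val]
        rw [← mul_assoc, ← mul_assoc, ← mul_assoc, CauchyCompletion.val_mul_hom,
          CauchyCompletion.hom_mul_val])
    have hψ p : ψ (unitPoint f p).1 = p := by
      change P.map (CauchyCompletion.homMk (f.val * f.val * f.val) _ _ : f ⟶ f).op p = p
      have h : (CauchyCompletion.homMk (f.val * f.val * f.val)
          (by simp only [f.idem.eq]) (by rw [mul_assoc, f.idem.eq]) :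
          f ⟶ f) = 𝟙 f := by
        ext
        change f.val * f.val * f.val = f.val
        rw [f.idem.eq, f.idem.eq]
      rw [h, op_id, Functor.map_id_apply]
    intro p q h
    rw [← hψ p, ← hψ q, h]
  · rintro ⟨z, hz⟩
    induction z using PshTensor.ind with
    | h e p s hs =>
      refine ⟨P.map (CauchyCompletion.homMk (s * f.val) (by rw [← mul_assoc, hs])
        (by rw [mul_assoc, f.idem.eq]) : f ⟶ e).op p, Subtype.ext ?_⟩
      refine Eq.trans ?_ hz
      refine (mk_map _ p f.val f.idem.eq ?_).trans (mk_congr _ _ rfl ?_)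
      · rw [CauchyCompletion.homMk_val, ← mul_assoc, ← mul_assoc, hs]
      · rw [CauchyCompletion.homMk_val, mul_assoc, f.idem.eq]; rfl

/-- By a triangle identity the inverse is the unit tensored with `S`. Surjectivity of the unit makes
it a left inverse. -/
lemma tensorCounit_pshTensor_bijective :
    Function.Bijective (tensorCounit (S := S) (PshTensor P)) := by
  constructor
  · let σ : PshTensor P → PshTensor (fixedPoints (S := S) (PshTensor P)) := fun z =>
      Quot.map (fun a : PrePair P =>
        (⟨a.idem, PshTensor.unitPoint a.idem a.point, a.val, a.val_eq⟩ : PrePair (fixedPoints (S := S) (PshTensor P)))) (by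
        rintro _ _ ⟨r, p, t, ht⟩
        dsimp only
        rw [PshTensor.unitPoint_map]
        exact PrePair.Rel.mk r _ t ht) z
    have hσ z : σ (tensorCounit (PshTensor P) z) = z := by
      induction z using PshTensor.ind with
      | h e p s hs =>
        obtain ⟨q, rfl⟩ := (PshTensor.unitPoint_bijective e).2 p
        rw [tensorCounit_mk]
        change PshTensor.mk _ (e.val * s) _ = _
        exact PshTensor.mk_congr _ _ rfl hs
    exact Function.LeftInverse.injective hσ
  · intro z
    induction z using PshTensor.ind with
    | h e p s hs =>
      refine ⟨PshTensor.mk (PshTensor.unitPoint e p) s hs, ?_⟩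
      exact PshTensor.mk_congr _ _ rfl hs

end FixedPoints

/-! ### Closedness as bijectivity of the counit -/

section Closed

variable {S : Type u} [Semigroup S]

/-- The element `x ∈ X e` given by `x` with `x e = x`. -/
def fixedPoint {X : Type u} [SemigroupAction Sᵐᵒᵖ X] (e : CauchyCompletion S) (x : X)
    (hx : x <• e.val = x) : (fixedPoints (S := S) X).obj (Opposite.op e) := ⟨x, hx⟩

/-- The pure tensor `x ⊗ s`. -/
def TensorProd.mk {X Y : Type u} [SemigroupAction Sᵐᵒᵖ X] [SemigroupAction S Y] (x : X) (y : Y) :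
    TensorProd S X Y := Quot.mk _ (x, y)

lemma TensorProd.mk_act {X Y : Type u} [SemigroupAction Sᵐᵒᵖ X] [SemigroupAction S Y] (x : X)
    (s : S) (y : Y) : mk (S := S) (x <• s) y = mk x (s • y) :=
  Quot.sound ⟨x, s, y, rfl, rfl⟩

/-- A form of `PshTensor.mk_map` with the side conditions as separate equations, to avoid rewriting
inside dependent types. -/
lemma PshTensor.mk_fixedPoint_act {X : Type u} [SemigroupAction Sᵐᵒᵖ X] {f e : CauchyCompletion S}
    (x y : X) (hx : x <• e.val = x) (hy : y <• f.val = y) (r t s : S) (her : e.val * r = r)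
    (hrf : r * f.val = r) (hyx : y = x <• r) (ht : f.val * t = t) (hs : e.val * s = s)
    (hrt : r * t = s) :
    mk (fixedPoint f y hy) t ht = mk (fixedPoint e x hx) s hs := by
  subst hyx hrt
  exact mk_map (CauchyCompletion.homMk r her hrf) (fixedPoint e x hx) t ht hs

lemma HasRightLocalUnits.isSandwich (h : HasRightLocalUnits S) : IsSandwich S := by
  intro s
  obtain ⟨t, e, he, rfl⟩ := h s
  exact ⟨t, e, e, he, by rw [mul_assoc, he.eq]⟩

lemma HasRightLocalUnits.exists_mul_eq (h : HasRightLocalUnits S) (s : S) :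
    ∃ e : CauchyCompletion S, s * e.val = s := by
  obtain ⟨t, e, he, rfl⟩ := h s
  exact ⟨⟨e, he⟩, by rw [mul_assoc, he.eq]⟩

/-- If every point of `X` is fixed by an idempotent, then `X ⊗ S` is the tensor product over
`C(S)`, as a set over `X`. -/
lemma HasRightLocalUnits.exists_bijective (h : HasRightLocalUnits S) (X : Type u)
    [SemigroupAction Sᵐᵒᵖ X] (hX : ∀ x : X, ∃ e : CauchyCompletion S, x <• e.val = x) :
    ∃ φ : PshTensor (fixedPoints (S := S) X) → TensorProd S X S,
      Function.Bijective φ ∧ tensorAct S X ∘ φ = tensorCounit X := by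
  choose u hu using h.exists_mul_eq
  let φ : PshTensor (fixedPoints (S := S) X) → TensorProd S X S :=
    PshTensor.lift (fun e x s => TensorProd.mk x.1 s)
      (fun f e r p t _ => TensorProd.mk_act p.1 r.1 t)
  have hfix (x : X) (t : S) : (x <• t) <• (u t).val = x <• t := by rw [act_act, hu]
  -- In short, `x t ⊗ g = x ⊗ e t`. The right side does not involve `g`, so the choice of a local
  -- unit for `t` is immaterial.
  have key (x : X) (e f g : CauchyCompletion S) (hx : x <• e.val = x) (hx' : x <• f.val = x)
      (t : S) (ht : t * g.val = t) (hxt : (x <• t) <• g.val = x <• t) :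
      PshTensor.mk (fixedPoint g (x <• t) hxt) g.val g.idem.eq =
        PshTensor.mk (fixedPoint e x hx) (e.val * t) (by rw [← mul_assoc, e.idem.eq]) := by
    apply PshTensor.mk_fixedPoint_act (r := e.val * t)
    · rw [← mul_assoc, e.idem.eq]
    · rw [mul_assoc, ht]
    · rw [← act_act, hx]
    · rw [mul_assoc, ht]
  let ψ : TensorProd S X S → PshTensor (fixedPoints (S := S) X) :=
    Quot.lift (fun p => PshTensor.mk (fixedPoint (u p.2) (p.1 <• p.2) (hfix p.1 p.2))
      (u p.2).val (u p.2).idem.eq) (by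
      rintro _ _ ⟨x, s, t, rfl, rfl⟩
      obtain ⟨e, he⟩ := hX x
      dsimp only
      have hst : s • t * (u t).val = s • t := by
        change s * t * (u t).val = s * t
        rw [mul_assoc, hu]
      have h1 : x <• (s • t) <• (u t).val = x <• (s • t) := by rw [act_act, hst]
      refine Eq.trans ?_ ((key x e e (u t) he he (s • t) hst h1).trans
        (key x e e (u (s • t)) he he (s • t) (hu _) (hfix _ _)).symm)
      exact PshTensor.mk_congr _ _ (Subtype.ext (act_act x s t)) rfl)
  refine ⟨φ, ⟨?_, ?_⟩, ?_⟩
  · refine Function.LeftInverse.injective (g := ψ) fun z => ?_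
    induction z using PshTensor.ind with
    | h e x s hs =>
      refine (key x.1 e e (u s) x.2 x.2 s (hu s) (hfix _ _)).trans ?_
      exact PshTensor.mk_congr _ _ rfl hs
  · rintro ⟨x, s⟩
    obtain ⟨e, he⟩ := hX x
    refine ⟨PshTensor.mk (fixedPoint e x he) (e.val * s) (by rw [← mul_assoc, e.idem.eq]), ?_⟩
    change TensorProd.mk x (e.val * s) = TensorProd.mk x s
    exact (TensorProd.mk_act x e.val s).symm.trans (by rw [he])
  · funext z
    induction z using PshTensor.ind with
    | h e x s hs => rfl

/-- Either bijection forces `X S = X`. Local units then give each point an idempotent fixing it, and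
the comparison over `X` applies. -/
lemma HasRightLocalUnits.isClosedAct_iff (h : HasRightLocalUnits S) (X : Type u)
    [SemigroupAction Sᵐᵒᵖ X] :
    IsClosedAct S X ↔ Function.Bijective (tensorCounit (S := S) X) := by
  have main (hX : ∀ x : X, ∃ (y : X) (s : S), y <• s = x) :
      IsClosedAct S X ↔ Function.Bijective (tensorCounit (S := S) X) := by
    obtain ⟨φ, hφ, hc⟩ := h.exists_bijective X fun x => by
      obtain ⟨y, s, rfl⟩ := hX x
      obtain ⟨e, he⟩ := h.exists_mul_eq s
      exact ⟨e, by rw [act_act, he]⟩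
    rw [← hc]
    exact (Function.Bijective.of_comp_iff _ hφ).symm
  constructor
  · intro hb
    refine (main fun x => ?_).1 hb
    obtain ⟨⟨y, s⟩, hy⟩ := hb.2 x
    exact ⟨y, s, hy⟩
  · intro hb
    refine (main fun x => ?_).2 hb
    obtain ⟨⟨e, y, s, hs⟩, hy⟩ := hb.2 x
    exact ⟨y.1, s, hy⟩

/-- The map `s ↦ x s` from `S` to `X`. -/
def RegularHom.ofPoint {X : Type u} [SemigroupAction Sᵐᵒᵖ X] (x : X) : RegularHom S X where
  toFun s := x <• s
  map_smul' r s := (act_act x s r.unop).symm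

/-- The element `s ↦ x s` of `hom_S(S, X) S`, for `x ∈ X e`. -/
def RegularHomMul.ofPoint {X : Type u} [SemigroupAction Sᵐᵒᵖ X] (e : S) (x : X)
    (hx : x <• e = x) : RegularHomMul S X :=
  ⟨RegularHom.ofPoint x, RegularHom.ofPoint x, e, MulActionHom.ext fun s => by
    change x <• s = x <• (e * s)
    rw [← act_act, hx]⟩

lemma RegularHom.map_mul {X : Type u} [SemigroupAction Sᵐᵒᵖ X] (β : RegularHom S X) (s t : S) :
    MulActionHom.toFun β (s * t) = MulActionHom.toFun β s <• t :=
  MulActionHom.map_smul' β (MulOpposite.op t) s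

/-- For a sandwich semigroup, `hom_S(S, X) S ⊗ S` is the tensor product over `C(S)`, as a set
over `X`. -/
lemma IsSandwich.exists_bijective (h : IsSandwich S) (X : Type u) [SemigroupAction Sᵐᵒᵖ X] :
    ∃ φ : PshTensor (fixedPoints (S := S) X) → TensorProd S (RegularHomMul S X) S,
      Function.Bijective φ ∧ homTensorEval S X ∘ φ = tensorCounit X := by
  have h' (s : S) : ∃ (a : S) (e : CauchyCompletion S) (b : S), a * e.val * b = s := by
    obtain ⟨a, e, b, he, hs⟩ := h s
    exact ⟨a, ⟨e, he⟩, b, hs⟩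
  choose a u b hab using h'
  let φ : PshTensor (fixedPoints (S := S) X) → TensorProd S (RegularHomMul S X) S :=
    PshTensor.lift (fun e x s => TensorProd.mk (RegularHomMul.ofPoint e.val x.1 x.2) s)
      (fun f e r x t _ => by
        refine Eq.trans ?_ (TensorProd.mk_act (RegularHomMul.ofPoint e.val x.1 x.2) r.1 t)
        congr 1
        exact Subtype.ext (MulActionHom.ext fun s => act_act x.1 r.1 s))
  have hfix (β : RegularHom S X) (p : S) (g : CauchyCompletion S) :
      MulActionHom.toFun β (p * g.val) <• g.val = MulActionHom.toFun β (p * g.val) := by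
    rw [← RegularHom.map_mul, mul_assoc, g.idem.eq]
  have hl (g : CauchyCompletion S) (q : S) : g.val * (g.val * q) = g.val * q := by
    rw [← mul_assoc, g.idem.eq]
  -- The inverse will send `β ⊗ p g q` to `β(p g) ⊗ g q`. For `β = α (c e d)` this is `α(c e) ⊗ e d
  -- p g q`, which depends only on the product `p g q`. Here it matters that `β` lies in `hom_S(S,
  -- X) S`.
  have key (α : RegularHom S X) (c d : S) (e : CauchyCompletion S) (p q : S)
      (g : CauchyCompletion S) :
      PshTensor.mk (fixedPoint g
          (MulActionHom.toFun (α <• (c * e.val * d)) (p * g.val)) (hfix _ p g))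
        (g.val * q) (hl g q) =
      PshTensor.mk (fixedPoint e (MulActionHom.toFun α (c * e.val)) (hfix α c e))
        (e.val * (d * (p * g.val * q))) (hl e _) := by
    apply PshTensor.mk_fixedPoint_act (r := e.val * (d * (p * g.val)))
    · exact hl _ _
    · simp only [mul_assoc, g.idem.eq]
    · rw [← RegularHom.map_mul]
      change MulActionHom.toFun α (c * e.val * d * (p * g.val)) = _
      congr 1
      simp only [mul_assoc]
      rw [← mul_assoc e.val e.val, e.idem.eq]
    · simp only [mul_assoc]
      rw [← mul_assoc g.val g.val, g.idem.eq]
  have indep (β : RegularHomMul S X) (s p q p' q' : S) (g g' : CauchyCompletion S)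
      (hs : p * g.val * q = s) (hs' : p' * g'.val * q' = s) :
      PshTensor.mk (fixedPoint g (MulActionHom.toFun β.1 (p * g.val)) (hfix _ p g))
        (g.val * q) (hl g q) =
      PshTensor.mk (fixedPoint g' (MulActionHom.toFun β.1 (p' * g'.val)) (hfix _ p' g'))
        (g'.val * q') (hl g' q') := by
    obtain ⟨_, α, t, rfl⟩ := β
    dsimp only
    have ht := hab t
    generalize a t = c, u t = e, b t = d at ht
    subst ht
    rw [key, key]
    subst hs
    exact PshTensor.mk_congr _ _ rfl (by rw [hs'])
  let ψ : TensorProd S (RegularHomMul S X) S → PshTensor (fixedPoints (S := S) X) :=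
    Quot.lift (fun z => PshTensor.mk
      (fixedPoint (u z.2) (MulActionHom.toFun z.1.1 (a z.2 * (u z.2).val)) (hfix _ _ _))
      ((u z.2).val * b z.2) (hl _ _)) (by
      rintro _ _ ⟨β, r, s, rfl, rfl⟩
      dsimp only
      refine Eq.trans ?_ (indep β (r * s) (r * a s) (b s) _ _ (u s) _
        (by rw [← hab s]; simp only [mul_assoc, hab]) (hab _))
      refine PshTensor.mk_congr _ _ (Subtype.ext ?_) rfl
      exact congrArg (MulActionHom.toFun β.1) (mul_assoc _ _ _).symm)
  refine ⟨φ, ⟨?_, ?_⟩, ?_⟩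
  · refine Function.LeftInverse.injective (g := ψ) fun z => ?_
    induction z using PshTensor.ind with
    | h e x s hs =>
      have hx : x.1 <• e.val = x.1 := x.2
      refine PshTensor.mk_fixedPoint_act x.1 _ hx (hfix _ _ _) (e.val * (a s * (u s).val)) _ _
        (hl _ _) ?_ ?_ _ hs ?_
      · simp only [mul_assoc, (u s).idem.eq]
      · rw [← act_act, hx]; rfl
      · rw [← mul_assoc, mul_assoc e.val, mul_assoc (a s), (u s).idem.eq, mul_assoc, hab, hs]
  · rintro ⟨⟨_, α, t, rfl⟩, s⟩
    have ht := hab t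
    generalize a t = c, u t = e, b t = d at ht
    subst ht
    refine ⟨PshTensor.mk (fixedPoint e (MulActionHom.toFun α (c * e.val)) (hfix α c e))
      (e.val * (d * s)) (hl _ _), ?_⟩
    refine (TensorProd.mk_act (RegularHomMul.ofPoint e.val _ (hfix α c e)) e.val
      -- Moving `e` and then `d` across the tensor sign leaves an equality of maps: `r ↦ α(c e) e d
      -- r` is `α (c e d)`.
      (d * s)).symm.trans ?_
    refine (TensorProd.mk_act _ d s).symm.trans ?_
    refine congrArg (fun β => TensorProd.mk β s) (Subtype.ext (MulActionHom.ext fun r => ?_))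
    change MulActionHom.toFun α (c * e.val) <• (e.val * (d * r)) =
      MulActionHom.toFun α (c * e.val * d * r)
    rw [← RegularHom.map_mul]
    congr 1
    simp only [mul_assoc]
    rw [← mul_assoc e.val e.val, e.idem.eq]
  · funext z
    induction z using PshTensor.ind with
    | h e x s hs => rfl

lemma IsSandwich.isTalwarClosedAct_iff (h : IsSandwich S) (X : Type u)
    [SemigroupAction Sᵐᵒᵖ X] :
    IsTalwarClosedAct S X ↔ Function.Bijective (tensorCounit (S := S) X) := by
  obtain ⟨φ, hφ, hc⟩ := h.exists_bijective X
  rw [← hc]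
  exact (Function.Bijective.of_comp_iff _ hφ).symm

lemma HasRightLocalUnits.isClosedAct_iff_isTalwarClosedAct (h : HasRightLocalUnits S) (X : Type u)
    [SemigroupAction Sᵐᵒᵖ X] : IsClosedAct S X ↔ IsTalwarClosedAct S X :=
  (h.isClosedAct_iff X).trans (h.isSandwich.isTalwarClosedAct_iff X).symm

end Closed

/-! ### The equivalence with presheaves -/

section Equivalence

variable {S : Type u} [Semigroup S]

/-- A morphism of presheaves `e ↦ X e` to `e ↦ Y e` comes from a unique equivariant map if the
counit of `X` is bijective. -/
lemma existsUnique_of_tensorCounit_bijective {X Y : Type u} [SemigroupAction Sᵐᵒᵖ X]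
    [SemigroupAction Sᵐᵒᵖ Y] (hX : Function.Bijective (tensorCounit (S := S) X))
    (τ : fixedPoints (S := S) X ⟶ fixedPoints (S := S) Y) :
    ∃! φ : X →[Sᵐᵒᵖ] Y, ∀ (e : CauchyCompletion S)
      (x : (fixedPoints (S := S) X).obj (Opposite.op e)), φ x.1 = (τ.app _ x).1 := by
  let ρ : PshTensor (fixedPoints (S := S) X) → Y :=
    PshTensor.lift (fun e x s => (τ.app (Opposite.op e) x).1 <• s) (fun f e r x t _ => by
      rw [NatTrans.naturality_apply]
      exact act_act _ _ _)
  let ε := Equiv.ofBijective _ hX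
  have hε (e : CauchyCompletion S) (x : (fixedPoints (S := S) X).obj (Opposite.op e)) (s : S)
      (hs : e.val * s = s) : ρ (ε.symm (x.1 <• s)) = (τ.app (Opposite.op e) x).1 <• s := by
    rw [show x.1 <• s = ε (PshTensor.mk x s hs) from rfl, Equiv.symm_apply_apply]
    rfl
  refine ⟨⟨fun x => ρ (ε.symm x), fun r x => ?_⟩, fun e x => ?_, fun φ hφ => ?_⟩
  · obtain ⟨z, rfl⟩ := ε.surjective x
    induction z using PshTensor.ind with
    | h e x s hs =>
      change ρ (ε.symm ((x.1 <• s) <• r.unop)) = ρ (ε.symm (x.1 <• s)) <• r.unop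
      rw [act_act, hε e x s hs, hε e x _ (by rw [← mul_assoc, hs]), act_act]
  · have hx : x.1 <• e.val = x.1 := x.2
    have h1 := hε e x e.val e.idem.eq
    rw [hx] at h1
    exact h1.trans (τ.app _ x).2
  · ext x
    obtain ⟨z, rfl⟩ := ε.surjective x
    induction z using PshTensor.ind with
    | h e x s hs =>
      refine Eq.trans ?_ (hε e x s hs).symm
      refine (map_act φ x.1 s).trans ?_
      rw [hφ]

/-- The functor `X ↦ (e ↦ X e)` on the `S`-sets that are closed in the sense of Talwar. -/
abbrev talwarFixedPointsFunctor (S : Type u) [Semigroup S] :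
    TalwarClosedSet S ⥤ ((CauchyCompletion S)ᵒᵖ ⥤ Type u) :=
  ObjectProperty.ι _ ⋙ fixedPointsFunctor S

/-- Bijectivity of the counit gives full faithfulness. The sets `P ⊗ S` are closed and the unit is
bijective, which gives essential surjectivity. -/
lemma IsSandwich.isEquivalence (h : IsSandwich S) : (talwarFixedPointsFunctor S).IsEquivalence where
  faithful := ⟨fun {X Y} φ ψ hφψ => by
    have hX := (h.isTalwarClosedAct_iff X.obj.carrier).1 X.property
    refine ObjectProperty.hom_ext _ ((existsUnique_of_tensorCounit_bijective hX
      ((talwarFixedPointsFunctor S).map φ)).unique (fun e x => rfl) fun e x => ?_)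
    rw [hφψ]
    rfl⟩
  full := ⟨fun {X Y} τ => by
    have hX := (h.isTalwarClosedAct_iff X.obj.carrier).1 X.property
    obtain ⟨φ, hφ, -⟩ := existsUnique_of_tensorCounit_bijective hX τ
    refine ⟨ObjectProperty.homMk φ, ?_⟩
    ext e x
    exact Subtype.ext (hφ e.unop x)⟩
  essSurj := ⟨fun P => by
    refine ⟨⟨⟨PshTensor P⟩, (h.isTalwarClosedAct_iff _).2 tensorCounit_pshTensor_bijective⟩,
      ⟨Iso.symm (NatIso.ofComponents
        (fun e => (Equiv.ofBijective _ (PshTensor.unitPoint_bijective e.unop)).toIso) ?_)⟩⟩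
    intro f e r
    ext p
    exact PshTensor.unitPoint_map r.unop p⟩

end Equivalence

end SemigroupMorita

theorem mainTheorem12 :
    (∀ (S T : Type u) [Semigroup S] [Semigroup T],
      SemigroupMorita.HasRightLocalUnits S → SemigroupMorita.HasRightLocalUnits T →
      (Nonempty (SemigroupMorita.ClosedSet S ≌ SemigroupMorita.ClosedSet T) ↔
        SemigroupMorita.HasMoritaContext
          (SemigroupMorita.CauchyCompletion S) (SemigroupMorita.CauchyCompletion T))) ∧
    (∀ (S : Type u) [Semigroup S], SemigroupMorita.IsSandwich S →
      Nonempty (SemigroupMorita.TalwarClosedSet S ≌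
        ((SemigroupMorita.CauchyCompletion S)ᵒᵖ ⥤ Type u))) ∧
    (∀ (S T : Type u) [Semigroup S] [Semigroup T],
      SemigroupMorita.IsSandwich S → SemigroupMorita.IsSandwich T →
      (Nonempty (SemigroupMorita.TalwarClosedSet S ≌ SemigroupMorita.TalwarClosedSet T) ↔
        SemigroupMorita.HasMoritaContext
          (SemigroupMorita.CauchyCompletion S) (SemigroupMorita.CauchyCompletion T))) := by
  have h2 (S : Type u) [Semigroup S] (hS : SemigroupMorita.IsSandwich S) :
      Nonempty (SemigroupMorita.TalwarClosedSet S ≌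
        ((SemigroupMorita.CauchyCompletion S)ᵒᵖ ⥤ Type u)) := by
    have := hS.isEquivalence
    exact ⟨(SemigroupMorita.talwarFixedPointsFunctor S).asEquivalence⟩
  have h3 (S T : Type u) [Semigroup S] [Semigroup T] (hS : SemigroupMorita.IsSandwich S)
      (hT : SemigroupMorita.IsSandwich T) :
      Nonempty (SemigroupMorita.TalwarClosedSet S ≌ SemigroupMorita.TalwarClosedSet T) ↔
        SemigroupMorita.HasMoritaContext
          (SemigroupMorita.CauchyCompletion S) (SemigroupMorita.CauchyCompletion T) := by
    obtain ⟨a⟩ := h2 S hS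
    obtain ⟨b⟩ := h2 T hT
    rw [← SemigroupMorita.nonempty_presheaf_equivalence_iff]
    exact ⟨fun ⟨e⟩ => ⟨a.symm.trans (e.trans b)⟩, fun ⟨e⟩ => ⟨a.trans (e.trans b.symm)⟩⟩
  have hclosed (S : Type u) [Semigroup S] (hS : SemigroupMorita.HasRightLocalUnits S) :
      (fun X : SemigroupMorita.RightSet S => SemigroupMorita.IsClosedAct S X.carrier) =
        fun X : SemigroupMorita.RightSet S => SemigroupMorita.IsTalwarClosedAct S X.carrier :=
    funext fun X => propext (hS.isClosedAct_iff_isTalwarClosedAct X.carrier)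
  refine ⟨fun S T _ _ hS hT => ?_, fun S _ => h2 S, fun S T _ _ => h3 S T⟩
  rw [← h3 S T hS.isSandwich hT.isSandwich]
  unfold SemigroupMorita.ClosedSet SemigroupMorita.TalwarClosedSet
  -- The closed sets and the Talwar closed sets are cut out by equal predicates, so the two full
  -- subcategories coincide.
  rw [hclosed S hS, hclosed T hT]
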